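/- Let $(x,y)$ have joint distribution $P$ on $\mathcal X\times\{+1,-1\}$ (for example $\mathcal X=\mathbb R^d$), with class priors $\pi_p=P(y=+1)>0$ and $\pi_n=P(y=-1)>0$, class-conditional distributions $p_p=P(x\mid y=+1)$ and $p_n=P(x\mid y=-1)$, and marginal distribution $p=\pi_p p_p+\pi_n p_n$ of $x$. Let $x^p_1,\dots,x^p_{n_p}\sim p_p$, $x^n_1,\dots,x^n_{n_n}\sim p_n$ and $x^u_1,\dots,x^u_{n_u}\sim p$ be independent samples, all drawn independently, with $n_p,n_n,n_u\ge 1$, and let $a\in(0,1)$. Let $\mathcal G$ be a class of measurable functions $g:\mathcal X\to\mathbb R$ with $\|g\|_\infty\le C_g$ for all $g\in\mathcal G$, such that the suprema over $\mathcal G$ of weighted sums of sample values and means of $\varphi(g)$, for continuous $\varphi:\mathbb R\to\mathbb R$, are measurable functions of the sample. Let $\ell:\mathbb R\times\{+1,-1\}\to\mathbb R$ be a loss with $0\le \ell(t,y)\le C_\ell$ for all $|t|\le C_g$ and $y\in\{+1,-1\}$, where $C_\ell>0$, and such that $t\mapsto\ell(t,+1)$ and $t\mapsto\ell(t,-1)$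 are $L_\ell$-Lipschitz on $\{t:|t|\le C_g\}$. Let $\mathcal R(g)=\mathbb E_{(x,y)\sim P}[\ell(g(x),y)]$ and let $g^*$ be a minimizer of $\mathcal R$ over $\mathcal G$. Let $$\hat{\mathcal R}^2_s(g)=\frac{a}{n_u}\sum_{i=1}^{n_u}\ell(g(x^u_i),+1)+\frac{(1-a)\pi_p}{n_p}\sum_{i=1}^{n_p}\ell(g(x^p_i),+1)+\frac{\pi_n}{n_n}\sum_{i=1}^{n_n}\ell(g(x^n_i),-1)-\frac{a\pi_n}{n_n}\sum_{i=1}^{n_n}\ell(g(x^n_i),+1),$$ and for a distribution $q$ on $\mathcal X$ let $$\mathfrak R_{n,q}(\mathcal G)=\mathbb E_{Z\sim q^n}\,\mathbb E_\sigma\Big[\sup_{g\in\mathcal G}\frac1n\sum_{i=1}^n\sigma_i g(Z_i)\Big],$$ with $\sigma_1,\dots,\sigma_n$ independent and uniform on $\{-1,+1\}$. Then for every $\delta\in(0,1)$, with probability at least $1-\delta$ over the samples, every minimizer $\hat g^2$ of $\hat{\mathcal R}^2_s$ over $\mathcal G$ satisfies $$\mathcal R(\hat g^2)-\mathcal R(g^*)\le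 4(1-a)\pi_pL_\ell\,\mathfrak R_{n_p,p_p}(\mathcal G)+4(1+a)\pi_nL_\ell\,\mathfrak R_{n_n,p_n}(\mathcal G)+4aL_\ell\,\mathfrak R_{n_u,p}(\mathcal G)+2C_\ell\sqrt{\frac{\ln(6/\delta)}{2}}\Big(\frac{(1-a)\pi_p}{\sqrt{n_p}}+\frac{(1+a)\pi_n}{\sqrt{n_n}}+\frac{a}{\sqrt{n_u}}\Big).$$ -/

import Mathlib

open MeasureTheory ProbabilityTheory

noncomputable section

/-- Labels `+1` and `-1`, realised as the units `1` and `-1` of `ℤ`. -/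
abbrev Label : Type := ℤˣ

variable {X : Type*} [MeasurableSpace X]

/-- Class prior `P(y = c)` of a joint distribution of `(x, y)`. -/
def classPrior (P : Measure (X × Label)) (c : Label) : ℝ :=
  P.real (Prod.snd ⁻¹' {c})

/-- Class-conditional distribution of `x` given `y = c`. -/
def classCond (P : Measure (X × Label)) (c : Label) : Measure X :=
  (ProbabilityTheory.cond P (Prod.snd ⁻¹' {c})).map Prod.fst

/-- Marginal distribution of `x`, from which the unlabeled data are drawn. -/
def marginal (P : Measure (X × Label)) : Measure X :=
  P.map Prod.fst

/-- The law of an i.i.d. sample of size `n` from `q`. -/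
def iidSample (q : Measure X) (n : ℕ) : Measure (Fin n → X) :=
  Measure.pi fun _ => q

/-- The risk `E_{(x,y) ∼ P} ℓ(g(x), y)`. -/
def risk (P : Measure (X × Label)) (loss : ℝ → Label → ℝ) (g : X → ℝ) : ℝ :=
  ∫ z, loss (g z.1) z.2 ∂P

/-- The empirical mean `(1/n) ∑ i, ℓ(g(x i), c)` over a sample `x`. -/
def empRisk (loss : ℝ → Label → ℝ) {n : ℕ} (x : Fin n → X) (c : Label) (g : X → ℝ) : ℝ :=
  (1 / (n : ℝ)) * ∑ i, loss (g (x i)) c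

/-- The unbiased semi-supervised risk estimator
`a R̂ᵤ⁺ + (1 - a) πₚ R̂ₚ⁺ + πₙ R̂ₙ⁻ - a πₙ R̂ₙ⁺` computed from a positive sample `xp`,
a negative sample `xn` and an unlabeled sample `xu`. -/
def semiRisk (P : Measure (X × Label)) (loss : ℝ → Label → ℝ) (a : ℝ) {np nn nu : ℕ}
    (xp : Fin np → X) (xn : Fin nn → X) (xu : Fin nu → X) (g : X → ℝ) : ℝ :=
  a * empRisk loss xu 1 g + (1 - a) * classPrior P 1 * empRisk loss xp 1 g
    + classPrior P (-1) * empRisk loss xn (-1) g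
    - a * classPrior P (-1) * empRisk loss xn 1 g

/-- The joint law of the three independent i.i.d. samples (positive, negative, unlabeled). -/
def sampleLaw (P : Measure (X × Label)) (np nn nu : ℕ) :
    Measure ((Fin np → X) × (Fin nn → X) × (Fin nu → X)) :=
  (iidSample (classCond P 1) np).prod
    ((iidSample (classCond P (-1)) nn).prod (iidSample (marginal P) nu))

/-- Rademacher complexity of `G` for a sample of size `n` from `q`:
`E_{Z ∼ qⁿ} E_σ sup_{g ∈ G} (1/n) ∑ i, σ i * g (Z i)`, with `σ` uniform on `{-1, 1}ⁿ`. -/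
def rademacher (G : Set (X → ℝ)) (q : Measure X) (n : ℕ) : ℝ :=
  ∫ z, (1 / 2 ^ n : ℝ) * ∑ σ : Fin n → ℤˣ,
    ⨆ g : G, (1 / (n : ℝ)) * ∑ i, ((σ i : ℤ) : ℝ) * (g : X → ℝ) (z i) ∂(iidSample q n)

/-- The usual measurability convention for suprema over a (possibly uncountable) uniformly bounded
class `G`: its members are measurable, and so are the suprema over `G` of weighted sums of sample
values and a mean. It holds whenever each member of `G` is the pointwise limit of a sequence from
a fixed countable subclass, and also for the class of all measurable functions with values in
`[-C, C]` when `X` is `ℝ^d`. -/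
def MeasurableClass (G : Set (X → ℝ)) (q : Measure X) : Prop :=
  (∀ g ∈ G, Measurable g) ∧
  ∀ φ : ℝ → ℝ, Continuous φ → ∀ (n : ℕ) (b : ℝ) (c : Fin n → ℝ),
    Measurable (fun z : Fin n → X =>
      ⨆ g : G, (b * ∫ x, φ ((g : X → ℝ) x) ∂q + ∑ i, c i * φ ((g : X → ℝ) (z i))))

end

/-!
The semi-supervised estimator is unbiased: the marginal of `x` is the mixture of the two
class-conditional laws, so the extra positive losses on unlabeled data are compensated by those
removed from the positive and negative data (`risk_eq_semisupervised`). Comparing `ghat` with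
`gstar` through their estimated risks, the excess risk is at most twice the largest deviation over
`G` of the estimator from the risk, and this deviation splits into one term for each sample. On the
negative sample the two losses are treated as the single function `ℓ(t, -1) - a ℓ(t, +1)`, which has
Lipschitz constant `(1 + a) L` and takes values in an interval of length `(1 + a) Cl`.

For each sample, `exists_measurableSet_uniform_deviation` bounds the deviation uniformly over `G`.
The largest one-sided deviation moves by at most `w / n` when one sample point is changed, `w` being
the length of the range of the loss, so McDiarmid's inequality
(`hasSubgaussianMGF_of_boundedDifferences`) puts it within `w √(ln(1/η) / (2n))` of its mean with
probability at least `1 - η`. That inequality follows from Hoeffding's lemma by induction on the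
sample size, sub-Gaussian deviations being additive over product measures. The mean is at most twice
the Rademacher complexity of the composed class by symmetrization with a ghost sample
(`integral_ciSup_sub_le`), and the loss is then removed by the contraction principle
(`sum_signs_ciSup_le_of_contraction`). Three samples, two sides each, and `η = δ / 6` give the
claim.
-/

/-! ### The bounded-differences inequality -/

lemma integrable_of_abs_le {Ω : Type*} [MeasurableSpace Ω] {μ : Measure Ω} [IsFiniteMeasure μ]
    {f : Ω → ℝ} {B : ℝ} (hf : Measurable f) (hB : ∀ z, |f z| ≤ B) : Integrable f μ :=
  Integrable.of_bound hf.aestronglyMeasurable B (ae_of_all _ hB)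

lemma abs_integral_le_of_abs_le {Ω : Type*} [MeasurableSpace Ω] {μ : Measure Ω}
    [IsProbabilityMeasure μ] {f : Ω → ℝ} {B : ℝ} (hB : ∀ z, |f z| ≤ B) :
    |∫ z, f z ∂μ| ≤ B := by
  simpa using norm_integral_le_of_norm_le_const (μ := μ) (f := f) (C := B) (ae_of_all _ hB)

/-- Sub-Gaussian deviations tensorize: if `F` deviates from its mean over the first factor with
variance proxy `c₁`, and this mean deviates from the full mean with proxy `c₂`, then `F` deviates
from its full mean with proxy `c₁ + c₂`. -/
lemma hasSubgaussianMGF_prod {Ω Ω' : Type*} [MeasurableSpace Ω] [MeasurableSpace Ω']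
    {μ : Measure Ω} {ν : Measure Ω'} [IsProbabilityMeasure μ] [IsProbabilityMeasure ν]
    {F : Ω × Ω' → ℝ} {B : ℝ} (hF : Measurable F) (hB : ∀ z, |F z| ≤ B) {c₁ c₂ : NNReal}
    (h₁ : ∀ y, HasSubgaussianMGF (fun x => F (x, y) - ∫ x', F (x', y) ∂μ) c₁ μ)
    (h₂ : HasSubgaussianMGF (fun y => (∫ x, F (x, y) ∂μ) - ∫ z, F z ∂(μ.prod ν)) c₂ ν) :
    HasSubgaussianMGF (fun z => F z - ∫ z', F z' ∂(μ.prod ν)) (c₁ + c₂) (μ.prod ν) := by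
  have hint : ∀ t : ℝ, Integrable (fun z => Real.exp (t * (F z - ∫ z', F z' ∂(μ.prod ν))))
      (μ.prod ν) := fun t =>
    integrable_exp_mul_of_mem_Icc (a := -B - ∫ z', F z' ∂(μ.prod ν))
      (b := B - ∫ z', F z' ∂(μ.prod ν)) (by fun_prop) (ae_of_all _ fun z => by
        have := abs_le.1 (hB z)
        constructor <;> linarith)
  refine ⟨hint, fun t => ?_⟩
  have hint' := hint t
  set m := ∫ z', F z' ∂(μ.prod ν) with hm
  unfold mgf
  rw [integral_prod_symm _ hint']
  calc ∫ y, ∫ x, Real.exp (t * (F (x, y) - m)) ∂μ ∂ν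
      ≤ ∫ y, Real.exp (c₁ * t ^ 2 / 2) * Real.exp (t * ((∫ x, F (x, y) ∂μ) - m)) ∂ν := by
        refine integral_mono hint'.integral_prod_right ((h₂.integrable_exp_mul t).const_mul _)
          fun y => ?_
        have e : ∀ x, Real.exp (t * (F (x, y) - m))
            = Real.exp (t * (F (x, y) - ∫ x', F (x', y) ∂μ))
              * Real.exp (t * ((∫ x, F (x, y) ∂μ) - m)) := fun x => by
          rw [← Real.exp_add]; ring_nf
        simp only [e]
        rw [integral_mul_const]
        exact mul_le_mul_of_nonneg_right ((h₁ y).mgf_le t) (Real.exp_pos _).le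
    _ ≤ Real.exp (c₁ * t ^ 2 / 2) * Real.exp (c₂ * t ^ 2 / 2) := by
        rw [integral_const_mul]
        exact mul_le_mul_of_nonneg_left (h₂.mgf_le t) (Real.exp_pos _).le
    _ = _ := by rw [← Real.exp_add]; push_cast; ring_nf

/-- Hoeffding's lemma for a function of bounded oscillation. -/
lemma hasSubgaussianMGF_of_oscillation_le {Ω : Type*} [MeasurableSpace Ω] {μ : Measure Ω}
    [IsProbabilityMeasure μ] {f : Ω → ℝ} {B : ℝ} {c : NNReal} (hf : Measurable f)
    (hB : ∀ x, |f x| ≤ B) (hc : ∀ x x', f x - f x' ≤ c) :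
    HasSubgaussianMGF (fun x => f x - ∫ x', f x' ∂μ) ((c / 2) ^ 2) μ := by
  have : Nonempty Ω := μ.nonempty_of_neZero
  have hbdd : BddBelow (Set.range f) :=
    ⟨-B, by rintro _ ⟨x, rfl⟩; exact (abs_le.1 (hB x)).1⟩
  have key := hasSubgaussianMGF_of_mem_Icc (μ := μ) (a := ⨅ x, f x) (b := (⨅ x, f x) + c)
    hf.aemeasurable (ae_of_all _ fun x => ⟨ciInf_le hbdd x, by
      have : f x - c ≤ ⨅ x', f x' := le_ciInf fun x' => by linarith [hc x x']
      linarith⟩)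
  simpa using key

/-- **McDiarmid's inequality** for an i.i.d. sample, as a bound on the moment generating function:
a function that moves by at most `c` when one of its `n` arguments is changed is sub-Gaussian
about its mean with variance proxy `n * (c / 2) ^ 2`. -/
theorem hasSubgaussianMGF_of_boundedDifferences {X : Type*} [MeasurableSpace X] (q : Measure X)
    [IsProbabilityMeasure q] {B : ℝ} {c : NNReal} (n : ℕ) {f : (Fin n → X) → ℝ}
    (hf : Measurable f) (hB : ∀ z, |f z| ≤ B)
    (hc : ∀ (z : Fin n → X) i x, f (Function.update z i x) - f z ≤ c) :
    HasSubgaussianMGF (fun z => f z - ∫ z', f z' ∂(iidSample q n)) (n * (c / 2) ^ 2)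
      (iidSample q n) := by
  unfold iidSample
  induction n with
  | zero =>
    have : ∀ z, f z - ∫ z', f z' ∂(Measure.pi fun _ : Fin 0 => q) = 0 := fun z => by
      have e : f = fun _ => f z := funext fun z' => by rw [Subsingleton.elim z' z]
      rw [e]; simp
    simp [this]
  | succ n ih =>
    have hmp := (measurePreserving_piFinSuccAbove (fun _ : Fin (n + 1) => q) 0).symm
    set e := (MeasurableEquiv.piFinSuccAbove (fun _ : Fin (n + 1) => X) 0).symm
    have he : ∀ x y, e (x, y) = Fin.cons x y := fun x y => by
      simp [e, MeasurableEquiv.piFinSuccAbove_symm_apply, Fin.insertNthEquiv]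
    set F : X × (Fin n → X) → ℝ := fun p => f (e p) with hFdef
    have hF : Measurable F := hf.comp e.measurable
    have hFB : ∀ p, |F p| ≤ B := fun p => hB _
    have hint : ∫ z', f z' ∂(Measure.pi fun _ : Fin (n + 1) => q)
        = ∫ p, F p ∂(q.prod (Measure.pi fun _ : Fin n => q)) := (hmp.integral_comp' f).symm
    have h₁ : ∀ y, HasSubgaussianMGF (fun x => F (x, y) - ∫ x', F (x', y) ∂q) ((c / 2) ^ 2) q :=
      fun y => hasSubgaussianMGF_of_oscillation_le (by fun_prop) (fun x => hFB _) fun x x' => by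
        have := hc (Fin.cons x' y) 0 x
        simpa [hFdef, he, Fin.update_cons_zero] using this
    have hFx : ∀ y, Integrable (fun x => F (x, y)) q := fun y =>
      integrable_of_abs_le (by fun_prop) fun x => hFB _
    have h₂ := ih (f := fun y => ∫ x, F (x, y) ∂q)
      (hF.stronglyMeasurable.integral_prod_left'.measurable)
      (fun y => abs_integral_le_of_abs_le fun x => hFB _)
      (fun z i x => by
        rw [← integral_sub (hFx _) (hFx _)]
        calc _ ≤ ∫ _, (c : ℝ) ∂q := integral_mono ((hFx _).sub (hFx _)) (integrable_const _)
              fun x' => by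
                have := hc (Fin.cons x' z) i.succ x
                simpa [hFdef, he, Fin.cons_update] using this
          _ = c := by simp)
    rw [← integral_prod_symm F (integrable_of_abs_le hF hFB)] at h₂
    have key := hasSubgaussianMGF_prod hF hFB h₁ h₂
    rw [← hint] at key
    have hmap : Measure.map e (q.prod (Measure.pi fun _ : Fin n => q))
        = Measure.pi fun _ : Fin (n + 1) => q := hmp.map_eq
    refine ⟨fun t => ?_, fun t => ?_⟩
    · rw [← hmap, integrable_map_equiv]
      rw [hmap]
      exact key.integrable_exp_mul t
    · have := key.mgf_le t
      unfold mgf at this ⊢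
      rw [← hmp.integral_comp']
      refine this.trans (le_of_eq ?_)
      push_cast
      ring_nf

/-! ### The contraction principle -/

lemma bddAbove_range_of_abs_le {ι : Type*} {f : ι → ℝ} {B : ℝ} (h : ∀ i, |f i| ≤ B) :
    BddAbove (Set.range f) :=
  ⟨B, by rintro _ ⟨i, rfl⟩; exact (abs_le.1 (h i)).2⟩

lemma abs_ciSup_le_of_abs_le {ι : Type*} [Nonempty ι] {f : ι → ℝ} {B : ℝ} (h : ∀ i, |f i| ≤ B) :
    |⨆ i, f i| ≤ B := by
  refine abs_le.2 ⟨?_, ciSup_le fun i => (abs_le.1 (h i)).2⟩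
  obtain ⟨i⟩ := ‹Nonempty ι›
  exact (abs_le.1 (h i)).1.trans (le_ciSup (bddAbove_range_of_abs_le h) i)

lemma abs_sum_mul_le {n : ℕ} {B : ℝ} (c : Fin n → ℝ) {v : Fin n → ℝ} (h : ∀ k, |v k| ≤ B) :
    |∑ k, c k * v k| ≤ (∑ k, |c k|) * B := by
  rw [Finset.sum_mul]
  refine (Finset.abs_sum_le_sum_abs _ _).trans (Finset.sum_le_sum fun k _ => ?_)
  rw [abs_mul]
  exact mul_le_mul_of_nonneg_left (h k) (abs_nonneg _)

lemma sum_signs_succ {n : ℕ} (Φ : (Fin (n + 1) → ℤˣ) → ℝ) :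
    ∑ σ, Φ σ = ∑ σ : Fin n → ℤˣ, (Φ (Fin.cons 1 σ) + Φ (Fin.cons (-1) σ)) := by
  rw [← (Fin.consEquiv fun _ : Fin (n + 1) => ℤˣ).sum_comp, Fintype.sum_prod_type_right]
  refine Finset.sum_congr rfl fun σ _ => ?_
  rw [UnitsInt.univ, Finset.sum_pair (by decide)]
  rfl

/-- The one-coordinate step of the contraction principle. -/
lemma ciSup_add_ciSup_sub_le {ι : Type*} [Nonempty ι] {A s t : ι → ℝ} {B : ℝ}
    (hA : ∀ i, |A i| ≤ B) (ht : ∀ i, |t i| ≤ B) (h : ∀ i j, |s i - s j| ≤ |t i - t j|) :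
    (⨆ i, (A i + s i)) + ⨆ i, (A i - s i) ≤ (⨆ i, (A i + t i)) + ⨆ i, (A i - t i) := by
  have hp : ∀ i, A i + t i ≤ ⨆ i, (A i + t i) := le_ciSup <|
    bddAbove_range_of_abs_le (B := B + B) fun i => (abs_add_le _ _).trans (add_le_add (hA i) (ht i))
  have hm : ∀ i, A i - t i ≤ ⨆ i, (A i - t i) := le_ciSup <|
    bddAbove_range_of_abs_le (B := B + B) fun i => (abs_sub _ _).trans (add_le_add (hA i) (ht i))
  refine ciSup_add_ciSup_le fun i j => ?_
  have h1 := (le_abs_self _).trans (h i j)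
  rcases le_total 0 (t i - t j) with h0 | h0
  · rw [abs_of_nonneg h0] at h1
    linarith [hp i, hm j]
  · rw [abs_of_nonpos h0] at h1
    linarith [hp j, hm i]

/-- The **Ledoux–Talagrand contraction principle**, without absolute values: replacing each
coordinate `t k` by a contraction `s k` of it decreases the average over signs of the supremum.
The offset `u` lets the coordinates be replaced one at a time. -/
theorem sum_signs_ciSup_le_of_contraction {ι : Type*} [Nonempty ι] {B : ℝ} (n : ℕ) {Bu : ℝ}
    {u : ι → ℝ} {s t : Fin n → ι → ℝ} (hu : ∀ i, |u i| ≤ Bu) (hs : ∀ k i, |s k i| ≤ B)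
    (ht : ∀ k i, |t k i| ≤ B) (h : ∀ k i j, |s k i - s k j| ≤ |t k i - t k j|) :
    ∑ σ : Fin n → ℤˣ, ⨆ i, (u i + ∑ k, ((σ k : ℤ) : ℝ) * s k i)
      ≤ ∑ σ : Fin n → ℤˣ, ⨆ i, (u i + ∑ k, ((σ k : ℤ) : ℝ) * t k i) := by
  induction n generalizing u Bu with
  | zero => simp
  | succ n ih =>
    rw [sum_signs_succ, sum_signs_succ]
    simp only [Fin.sum_univ_succ, Fin.cons_zero, Fin.cons_succ, Units.val_one, Units.val_neg,
      Int.cast_one, Int.cast_neg, one_mul, neg_one_mul]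
    have hp := ih (u := fun i => u i + t 0 i) (Bu := Bu + B) (s := fun k => s k.succ)
      (t := fun k => t k.succ)
      (fun i => (abs_add_le _ _).trans (add_le_add (hu i) (ht 0 i)))
      (fun k => hs k.succ) (fun k => ht k.succ) fun k => h k.succ
    have hm := ih (u := fun i => u i - t 0 i) (Bu := Bu + B) (s := fun k => s k.succ)
      (t := fun k => t k.succ)
      (fun i => (abs_sub _ _).trans (add_le_add (hu i) (ht 0 i)))
      (fun k => hs k.succ) (fun k => ht k.succ) fun k => h k.succ
    calc _ ≤ ∑ σ : Fin n → ℤˣ,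
          ((⨆ i, (u i + t 0 i + ∑ k : Fin n, ((σ k : ℤ) : ℝ) * s k.succ i))
            + ⨆ i, (u i - t 0 i + ∑ k : Fin n, ((σ k : ℤ) : ℝ) * s k.succ i)) := by
          refine Finset.sum_le_sum fun σ _ => ?_
          have hS : ∀ i, |∑ k : Fin n, ((σ k : ℤ) : ℝ) * s k.succ i|
              ≤ (∑ k : Fin n, |((σ k : ℤ) : ℝ)|) * B :=
            fun i => abs_sum_mul_le _ fun k => hs k.succ i
          have := ciSup_add_ciSup_sub_le
            (A := fun i => u i + ∑ k : Fin n, ((σ k : ℤ) : ℝ) * s k.succ i) (s := s 0) (t := t 0)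
            (B := max (Bu + (∑ k : Fin n, |((σ k : ℤ) : ℝ)|) * B) B)
            (fun i => ((abs_add_le _ _).trans (add_le_add (hu i) (hS i))).trans (le_max_left _ _))
            (fun i => (ht 0 i).trans (le_max_right _ _)) (h 0)
          refine le_trans (le_of_eq ?_) (this.trans (le_of_eq ?_)) <;>
            congr 2 <;> funext i <;> ring
      _ ≤ _ := by
          rw [Finset.sum_add_distrib]
          refine (add_le_add hp hm).trans (le_of_eq ?_)
          rw [← Finset.sum_add_distrib]
          refine Finset.sum_congr rfl fun σ _ => ?_
          congr 2 <;> funext i <;> ring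

/-! ### Symmetrization -/

instance {X : Type*} [MeasurableSpace X] (q : Measure X) [IsProbabilityMeasure q] (n : ℕ) :
    IsProbabilityMeasure (iidSample q n) := by
  unfold iidSample; infer_instance

lemma MeasureTheory.MeasurePreserving.integral_comp_of_measurable {Ω Ω' : Type*}
    [MeasurableSpace Ω] [MeasurableSpace Ω'] {μ : Measure Ω} {ν : Measure Ω'} {T : Ω → Ω'}
    (h : MeasurePreserving T μ ν) {f : Ω' → ℝ} (hf : Measurable f) :
    ∫ x, f (T x) ∂μ = ∫ y, f y ∂ν := by
  rw [← h.map_eq, integral_map h.measurable.aemeasurable hf.aestronglyMeasurable]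

lemma iidSample_eval {X : Type*} [MeasurableSpace X] (q : Measure X) [IsProbabilityMeasure q]
    {n : ℕ} (k : Fin n) {f : X → ℝ} (hf : Measurable f) :
    ∫ z, f (z k) ∂(iidSample q n) = ∫ x, f x ∂q :=
  (measurePreserving_eval (fun _ : Fin n => q) k).integral_comp_of_measurable hf

/-- **Symmetrization**: the expected largest excess of the means of a class over its empirical
means is at most twice its Rademacher complexity. -/
theorem integral_ciSup_sub_le {X ι : Type*} [MeasurableSpace X] [Nonempty ι] (q : Measure X)
    [IsProbabilityMeasure q] {F : ι → X → ℝ} {B : ℝ} (hF : ∀ i, Measurable (F i))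
    (hB : ∀ i x, |F i x| ≤ B)
    (hM : ∀ (n : ℕ) (b : ℝ) (c : Fin n → ℝ), Measurable fun z : Fin n → X =>
      ⨆ i, (b * ∫ x, F i x ∂q + ∑ k, c k * F i (z k)))
    {n : ℕ} (hn : 0 < n) :
    ∫ z, ⨆ i, (1 * ∫ x, F i x ∂q + ∑ k, (-(1 / (n : ℝ))) * F i (z k)) ∂(iidSample q n)
      ≤ 2 * ((1 / 2 ^ n : ℝ) * ∑ σ : Fin n → ℤˣ,
          ∫ z, ⨆ i, (∑ k, (((σ k : ℤ) : ℝ) * (1 / (n : ℝ))) * F i (z k)) ∂(iidSample q n)) := by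
  set c : ℝ := 1 / (n : ℝ) with hc
  have hM0 : ∀ (n : ℕ) (c : Fin n → ℝ), Measurable fun z : Fin n → X =>
      ⨆ i, (∑ k, c k * F i (z k)) := fun n c => by simpa using hM n 0 c
  have hbd : ∀ {n : ℕ} (c : Fin n → ℝ) (z : Fin n → X) i,
      |∑ k, c k * F i (z k)| ≤ (∑ k, |c k|) * B := fun c z i => abs_sum_mul_le c fun k => hB i _
  -- the process comparing the sample `p.1` with an independent ghost sample `p.2`
  set S : (Fin n → X) × (Fin n → X) → ℝ := fun p =>
    ⨆ i, (∑ k, (-c) * F i (p.1 k) + ∑ k, c * F i (p.2 k)) with hS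
  have hSbd : ∀ (p : (Fin n → X) × (Fin n → X)) i,
      |∑ k, (-c) * F i (p.1 k) + ∑ k, c * F i (p.2 k)|
        ≤ (∑ _k : Fin n, |(-c)|) * B + (∑ _k : Fin n, |c|) * B := fun p i =>
    (abs_add_le _ _).trans (add_le_add (hbd (fun _ => -c) p.1 i) (hbd (fun _ => c) p.2 i))
  have hSm : Measurable S := by
    have := (hM0 (n + n) (Fin.append (fun _ => -c) fun _ => c)).comp
      (show Measurable fun p : (Fin n → X) × (Fin n → X) => Fin.append p.1 p.2 from
        measurable_pi_iff.2 fun k => by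
          refine Fin.addCases (fun k => ?_) (fun k => ?_) k <;>
            simp only [Fin.append_left, Fin.append_right] <;> fun_prop)
    simpa only [Function.comp_def, Fin.sum_univ_add, Fin.append_left, Fin.append_right] using this
  have hSi : Integrable S ((iidSample q n).prod (iidSample q n)) :=
    integrable_of_abs_le hSm fun p => abs_ciSup_le_of_abs_le (hSbd p)
  have step1 : ∫ z, ⨆ i, (1 * ∫ x, F i x ∂q + ∑ k, (-c) * F i (z k)) ∂(iidSample q n)
      ≤ ∫ p, S p ∂((iidSample q n).prod (iidSample q n)) := by
    rw [integral_prod _ hSi]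
    refine integral_mono (integrable_of_abs_le (hM n 1 fun _ => -c)
      (B := B + (∑ _k : Fin n, |(-c)|) * B) fun z => abs_ciSup_le_of_abs_le fun i => ?_)
      hSi.integral_prod_left fun z => ciSup_le fun i => ?_
    · rw [one_mul]
      exact (abs_add_le _ _).trans (add_le_add (abs_integral_le_of_abs_le (hB i))
        (hbd (fun _ => -c) z i))
    · have hmean : ∫ z', (∑ k, (-c) * F i (z k) + ∑ k, c * F i (z' k)) ∂(iidSample q n)
          = 1 * ∫ x, F i x ∂q + ∑ k, (-c) * F i (z k) := by
        have hi : ∀ k : Fin n, Integrable (fun z' : Fin n → X => c * F i (z' k))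
            (iidSample q n) := fun k =>
          (integrable_of_abs_le ((hF i).comp (measurable_pi_apply k)) fun z' =>
            hB i _).const_mul c
        rw [integral_add (integrable_const _) (integrable_finsetSum _ fun k _ => hi k),
          integral_finsetSum _ fun k _ => hi k]
        simp only [integral_const_mul, iidSample_eval q _ (hF i)]
        simp only [integral_const, Finset.sum_const, Finset.card_univ, Fintype.card_fin]
        have : (n : ℝ) ≠ 0 := by positivity
        simp [hc]
        field_simp
        ring
      rw [← hmean]
      refine integral_mono (integrable_of_abs_le (by
        have := fun k : Fin n => (hF i).comp (measurable_pi_apply (X := fun _ : Fin n => X) k)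
        simp only [Function.comp_def] at this
        fun_prop) fun z' => hSbd (z, z') i)
        (integrable_of_abs_le (by fun_prop) fun z' => abs_ciSup_le_of_abs_le (hSbd (z, z')))
        fun z' => le_ciSup (bddAbove_range_of_abs_le (hSbd (z, z'))) i
  -- exchanging the two copies at the places where the sign is `-1`
  have step2 : ∀ σ : Fin n → ℤˣ, ∫ p, S p ∂((iidSample q n).prod (iidSample q n))
      ≤ (∫ z, ⨆ i, (∑ k, (((σ k : ℤ) : ℝ) * c) * F i (z k)) ∂(iidSample q n))
        + ∫ z, ⨆ i, (∑ k, ((((-σ) k : ℤ) : ℝ) * c) * F i (z k)) ∂(iidSample q n) := by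
    intro σ
    have hA := measurePreserving_arrowProdEquivProdArrow X X (Fin n) (fun _ => q) (fun _ => q)
    set T : Fin n → X × X → X × X := fun k => if σ k = 1 then id else Prod.swap with hT
    have hTp : MeasurePreserving (fun (w : Fin n → X × X) k => T k (w k))
        (Measure.pi fun _ => q.prod q) (Measure.pi fun _ => q.prod q) := by
      refine measurePreserving_pi _ _ fun k => ?_
      by_cases h : σ k = 1
      · simp only [hT, h, if_true]; exact MeasurePreserving.id _
      · simp only [hT, h, if_false]; exact Measure.measurePreserving_swap
    have hfst : MeasurePreserving (fun (w : Fin n → X × X) k => (w k).1)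
        (Measure.pi fun _ => q.prod q) (iidSample q n) :=
      measurePreserving_pi _ _ fun k => measurePreserving_fst
    have hsnd : MeasurePreserving (fun (w : Fin n → X × X) k => (w k).2)
        (Measure.pi fun _ => q.prod q) (iidSample q n) :=
      measurePreserving_pi _ _ fun k => measurePreserving_snd
    have hRm : ∀ τ : Fin n → ℤˣ, Measurable fun z : Fin n → X =>
        ⨆ i, (∑ k, (((τ k : ℤ) : ℝ) * c) * F i (z k)) := fun τ => hM0 n _
    have hRb := fun (τ : Fin n → ℤˣ) (z : Fin n → X) i => hbd (fun k => ((τ k : ℤ) : ℝ) * c) z i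
    have e1 : ∫ p, S p ∂((iidSample q n).prod (iidSample q n))
        = ∫ w, S (MeasurableEquiv.arrowProdEquivProdArrow X X (Fin n) fun k => T k (w k))
            ∂(Measure.pi fun _ => q.prod q) := by
      rw [hTp.integral_comp_of_measurable
        (f := fun w => S (MeasurableEquiv.arrowProdEquivProdArrow X X (Fin n) w))
        (hSm.comp hA.measurable)]
      exact (hA.integral_comp_of_measurable hSm).symm
    have hi2 : Integrable (fun w : Fin n → X × X =>
        ⨆ i, (∑ k, (((σ k : ℤ) : ℝ) * c) * F i (w k).2)) (Measure.pi fun _ => q.prod q) :=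
      integrable_of_abs_le ((hRm σ).comp hsnd.measurable) fun w =>
        abs_ciSup_le_of_abs_le (hRb σ _)
    have hi1 : Integrable (fun w : Fin n → X × X =>
        ⨆ i, (∑ k, ((((-σ) k : ℤ) : ℝ) * c) * F i (w k).1)) (Measure.pi fun _ => q.prod q) :=
      integrable_of_abs_le ((hRm (-σ)).comp hfst.measurable) fun w =>
        abs_ciSup_le_of_abs_le (hRb (-σ) _)
    rw [e1, ← hsnd.integral_comp_of_measurable (hRm σ),
      ← hfst.integral_comp_of_measurable (hRm (-σ)), ← integral_add hi2 hi1]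
    refine integral_mono (integrable_of_abs_le ((hSm.comp hA.measurable).comp hTp.measurable)
      fun w => abs_ciSup_le_of_abs_le (hSbd _))
      (hi2.add hi1) fun w => ciSup_le fun i => ?_
    refine le_trans (le_of_eq ?_) (add_le_add
      (le_ciSup (bddAbove_range_of_abs_le (hRb σ fun k => (w k).2)) i)
      (le_ciSup (bddAbove_range_of_abs_le (hRb (-σ) fun k => (w k).1)) i))
    rw [← Finset.sum_add_distrib, ← Finset.sum_add_distrib]
    refine Finset.sum_congr rfl fun k _ => ?_
    change -c * F i (T k (w k)).1 + c * F i (T k (w k)).2 = _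
    rcases Int.units_eq_one_or (σ k) with h | h <;> simp [hT, h, add_comm]
  have step3 := Finset.sum_le_sum fun σ (_ : σ ∈ (Finset.univ : Finset (Fin n → ℤˣ))) => step2 σ
  have hneg := Equiv.sum_comp (Equiv.neg (Fin n → ℤˣ)) fun σ =>
    ∫ z, ⨆ i, (∑ k, (((σ k : ℤ) : ℝ) * c) * F i (z k)) ∂(iidSample q n)
  simp only [Equiv.neg_apply] at hneg
  rw [Finset.sum_add_distrib, hneg] at step3
  simp only [Finset.sum_const, Finset.card_univ, Fintype.card_fun, Fintype.card_fin,
    Fintype.card_units_int, nsmul_eq_mul, Nat.cast_pow, Nat.cast_ofNat] at step3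
  have h2 : (0 : ℝ) < 2 ^ n := by positivity
  refine step1.trans ?_
  rw [← mul_assoc, mul_one_div, div_mul_eq_mul_div, le_div_iff₀ h2]
  linarith

/-! ### Uniform deviations over a class -/

/-- The contraction principle for `rademacher`: composing a class with a `K`-Lipschitz function
multiplies its Rademacher complexity by at most `K`. -/
lemma sum_signs_integral_ciSup_le_rademacher {X : Type*} [MeasurableSpace X] {q : Measure X}
    [IsProbabilityMeasure q] {G : Set (X → ℝ)} (hne : G.Nonempty) {Cg : ℝ}
    (hG : ∀ g ∈ G, ∀ x, |g x| ≤ Cg) (hM : MeasurableClass G q) {φ : ℝ → ℝ} {K : NNReal}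
    (hφ : LipschitzWith K φ) {B : ℝ} (hB : ∀ t, |t| ≤ Cg → |φ t| ≤ B) (n : ℕ) :
    (1 / 2 ^ n : ℝ) * ∑ σ : Fin n → ℤˣ, ∫ z, ⨆ g : G, (∑ k, (((σ k : ℤ) : ℝ) * (1 / (n : ℝ)))
        * φ ((g : X → ℝ) (z k))) ∂(iidSample q n)
      ≤ K * rademacher G q n := by
  have : Nonempty G := hne.to_subtype
  set c : ℝ := 1 / (n : ℝ) with hc
  have hc0 : 0 ≤ c := by positivity
  have hRm : ∀ (ψ : ℝ → ℝ), Continuous ψ → ∀ σ : Fin n → ℤˣ, Measurable fun z : Fin n → X =>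
      ⨆ g : G, (∑ k, (((σ k : ℤ) : ℝ) * c) * ψ ((g : X → ℝ) (z k))) := fun ψ hψ σ => by
    simpa using hM.2 ψ hψ n 0 fun k => ((σ k : ℤ) : ℝ) * c
  have hRi : ∀ (ψ : ℝ → ℝ), Continuous ψ → ∀ b, (∀ t, |t| ≤ Cg → |ψ t| ≤ b) →
      ∀ σ : Fin n → ℤˣ, Integrable (fun z : Fin n → X =>
        ⨆ g : G, (∑ k, (((σ k : ℤ) : ℝ) * c) * ψ ((g : X → ℝ) (z k)))) (iidSample q n) :=
    fun ψ hψ b hb σ => integrable_of_abs_le (hRm ψ hψ σ) fun z => abs_ciSup_le_of_abs_le fun g =>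
      abs_sum_mul_le _ fun k => hb _ (hG g g.2 _)
  unfold rademacher
  rw [← hc, integral_const_mul, ← mul_assoc, mul_comm (K : ℝ), mul_assoc]
  refine mul_le_mul_of_nonneg_left ?_ (by positivity)
  rw [← integral_finsetSum _ fun σ _ => hRi φ hφ.continuous B hB σ, ← integral_const_mul]
  have hid := hRi id continuous_id Cg fun t ht => ht
  have hscale : ∀ (z : Fin n → X) (σ : Fin n → ℤˣ),
      ⨆ g : G, c * ∑ i, ((σ i : ℤ) : ℝ) * (g : X → ℝ) (z i)
        = ⨆ g : G, (∑ k, (((σ k : ℤ) : ℝ) * c) * id ((g : X → ℝ) (z k))) := fun z σ => by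
    congr 1; funext g
    rw [Finset.mul_sum]
    exact Finset.sum_congr rfl fun k _ => by simp only [id]; ring
  simp only [hscale]
  refine integral_mono (integrable_finsetSum _ fun σ _ => hRi φ hφ.continuous B hB σ)
    ((integrable_finsetSum _ fun σ _ => hid σ).const_mul _) fun z => ?_
  have key := sum_signs_ciSup_le_of_contraction (ι := G) (B := max (c * B) (c * (K * Cg))) n
    (u := fun _ => 0) (Bu := 0) (s := fun k g => c * φ ((g : X → ℝ) (z k)))
    (t := fun k g => c * (K * (g : X → ℝ) (z k))) (by simp)
    (fun k g => by
      rw [abs_mul, abs_of_nonneg hc0]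
      exact (mul_le_mul_of_nonneg_left (hB _ (hG g g.2 _)) hc0).trans (le_max_left _ _))
    (fun k g => by
      rw [abs_mul, abs_of_nonneg hc0, abs_mul, abs_of_nonneg K.coe_nonneg]
      exact (mul_le_mul_of_nonneg_left (mul_le_mul_of_nonneg_left (hG g g.2 _) K.coe_nonneg) hc0).trans
        (le_max_right _ _))
    (fun k g h => by
      rw [← mul_sub, ← mul_sub, ← mul_sub, abs_mul, abs_mul, abs_mul, abs_of_nonneg K.coe_nonneg]
      exact mul_le_mul_of_nonneg_left (by simpa [Real.dist_eq] using hφ.dist_le_mul _ _)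
        (abs_nonneg _))
  simp only [zero_add] at key
  dsimp only
  rw [Finset.mul_sum]
  simp only [Real.mul_iSup_of_nonneg K.coe_nonneg, Finset.mul_sum]
  simp only [id, mul_assoc, mul_left_comm (K : ℝ)] at key ⊢
  exact key

/-- One-sided uniform deviation: McDiarmid's inequality for the largest excess of the mean of
`φ ∘ g` over its empirical mean, whose expectation is bounded by symmetrization and
contraction. -/
lemma measureReal_lt_ciSup_sub_le {X : Type*} [MeasurableSpace X] {q : Measure X}
    [IsProbabilityMeasure q] {G : Set (X → ℝ)} (hne : G.Nonempty) {Cg : ℝ}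
    (hG : ∀ g ∈ G, ∀ x, |g x| ≤ Cg) (hM : MeasurableClass G q) {φ : ℝ → ℝ} {K : NNReal}
    (hφ : LipschitzWith K φ) {m w : ℝ} (hw : 0 < w) (hmw : ∀ t, |t| ≤ Cg → φ t ∈ Set.Icc m (m + w))
    {n : ℕ} (hn : 0 < n) {η : ℝ} (hη0 : 0 < η) (hη1 : η ≤ 1) :
    (iidSample q n).real {z | 2 * K * rademacher G q n
        + w * Real.sqrt (Real.log (1 / η) / 2) / Real.sqrt n
      < ⨆ g : G, (1 * ∫ x, φ ((g : X → ℝ) x) ∂q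
          + ∑ k, (-(1 / (n : ℝ))) * φ ((g : X → ℝ) (z k)))} ≤ η := by
  have : Nonempty G := hne.to_subtype
  have hn' : (0 : ℝ) < n := by exact_mod_cast hn
  set B : ℝ := |m| + w with hBdef
  have hB : ∀ t, |t| ≤ Cg → |φ t| ≤ B := fun t ht => by
    obtain ⟨h1, h2⟩ := hmw t ht
    rw [abs_le]
    constructor <;> linarith [neg_abs_le m, le_abs_self m]
  set D : (Fin n → X) → ℝ := fun z => ⨆ g : G, (1 * ∫ x, φ ((g : X → ℝ) x) ∂q
    + ∑ k, (-(1 / (n : ℝ))) * φ ((g : X → ℝ) (z k))) with hD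
  have hDm : Measurable D := hM.2 φ hφ.continuous n 1 fun _ => -(1 / (n : ℝ))
  have hDb : ∀ (z : Fin n → X) (g : G), |1 * ∫ x, φ ((g : X → ℝ) x) ∂q
      + ∑ k, (-(1 / (n : ℝ))) * φ ((g : X → ℝ) (z k))|
        ≤ B + (∑ _k : Fin n, |-(1 / (n : ℝ))|) * B := fun z g => by
    rw [one_mul]
    exact (abs_add_le _ _).trans (add_le_add
      (abs_integral_le_of_abs_le fun x => hB _ (hG g g.2 x))
      (abs_sum_mul_le _ fun k => hB _ (hG g g.2 _)))
  have hmean : ∫ z, D z ∂(iidSample q n) ≤ 2 * K * rademacher G q n := by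
    have h1 := integral_ciSup_sub_le (ι := G) q (F := fun g x => φ ((g : X → ℝ) x)) (B := B)
      (fun g => hφ.continuous.measurable.comp (hM.1 g g.2)) (fun g x => hB _ (hG g g.2 x))
      (fun n b c => hM.2 φ hφ.continuous n b c) hn
    have h2 := sum_signs_integral_ciSup_le_rademacher hne hG hM hφ hB n
    rw [mul_assoc]
    exact h1.trans (mul_le_mul_of_nonneg_left h2 two_pos.le)
  have hsub := hasSubgaussianMGF_of_boundedDifferences q (c := (w / n).toNNReal) n hDm
    (fun z => abs_ciSup_le_of_abs_le (hDb z)) (fun z i x => by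
      rw [Real.coe_toNNReal _ (by positivity), sub_le_iff_le_add']
      refine ciSup_le fun g => le_trans ?_
        (add_le_add_left (le_ciSup (bddAbove_range_of_abs_le (hDb z)) g) _)
      have hz := hmw _ (hG g g.2 (z i))
      have hx := hmw _ (hG g g.2 x)
      rw [← Finset.add_sum_erase _ _ (Finset.mem_univ i),
        ← Finset.add_sum_erase (a := i) (f := fun k => (-(1 / (n : ℝ))) * φ ((g : X → ℝ) (z k)))
          _ (Finset.mem_univ i), Finset.sum_congr rfl fun k hk => by
          rw [Function.update_of_ne (Finset.ne_of_mem_erase hk)]]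
      simp only [Function.update_self]
      have : (1 / (n : ℝ)) * (φ ((g : X → ℝ) (z i)) - φ ((g : X → ℝ) x)) ≤ w / n := by
        rw [one_div, inv_mul_eq_div]
        exact div_le_div_of_nonneg_right (by linarith [hz.2, hx.1]) hn'.le
      linarith)
  have hlog : 0 ≤ Real.log (1 / η) := Real.log_nonneg (by rw [le_div_iff₀ hη0]; linarith)
  refine le_trans (measureReal_mono (fun z hz => ?_) (measure_ne_top _ _))
    ((hsub.measure_ge_le
      (ε := w * Real.sqrt (Real.log (1 / η) / 2) / Real.sqrt n) (by positivity)).trans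
        (le_of_eq ?_))
  · simp only [Set.mem_ofPred_eq] at hz ⊢
    linarith
  · have hc : (((n : NNReal) * ((w / n).toNNReal / 2) ^ 2 : NNReal) : ℝ)
        = n * (w / n / 2) ^ 2 := by
      push_cast
      rw [Real.coe_toNNReal _ (by positivity)]
    rw [hc, div_pow, mul_pow, Real.sq_sqrt (by positivity), Real.sq_sqrt hn'.le]
    have : -(w ^ 2 * (Real.log (1 / η) / 2) / n) / (2 * (n * (w / n / 2) ^ 2)) = Real.log η := by
      rw [one_div, Real.log_inv]
      field_simp
    rw [this, Real.exp_log hη0]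

/-- Two-sided uniform deviation: with probability at least `1 - 2 * η`, simultaneously for all
`g ∈ G`, the mean of `ψ ∘ g` and its empirical mean differ by at most twice the Rademacher
complexity, scaled by the Lipschitz constant, plus a McDiarmid term. -/
theorem exists_measurableSet_uniform_deviation {X : Type*} [MeasurableSpace X] {q : Measure X}
    [IsProbabilityMeasure q] {G : Set (X → ℝ)} (hne : G.Nonempty) {Cg : ℝ}
    (hG : ∀ g ∈ G, ∀ x, |g x| ≤ Cg) (hM : MeasurableClass G q) {ψ : ℝ → ℝ} {K : NNReal}
    (hψ : LipschitzOnWith K ψ {t | |t| ≤ Cg}) {m w : ℝ} (hw : 0 < w)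
    (hmw : ∀ t, |t| ≤ Cg → ψ t ∈ Set.Icc m (m + w))
    {n : ℕ} (hn : 0 < n) {η : ℝ} (hη0 : 0 < η) (hη1 : η ≤ 1) :
    ∃ E : Set (Fin n → X), MeasurableSet E ∧ 1 - 2 * η ≤ (iidSample q n).real E ∧
      ∀ z ∈ E, ∀ g ∈ G, |∫ x, ψ (g x) ∂q - (1 / (n : ℝ)) * ∑ k, ψ (g (z k))|
        ≤ 2 * K * rademacher G q n + w * Real.sqrt (Real.log (1 / η) / 2) / Real.sqrt n := by
  have : Nonempty G := hne.to_subtype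
  -- the measurability convention speaks of functions continuous on all of `ℝ`
  obtain ⟨φ, hφ, heq⟩ := hψ.extend_real
  have hφψ : ∀ t, |t| ≤ Cg → φ t = ψ t := fun t ht => (heq ht).symm
  have hmwφ : ∀ t, |t| ≤ Cg → φ t ∈ Set.Icc m (m + w) := fun t ht => hφψ t ht ▸ hmw t ht
  set τ := 2 * K * rademacher G q n + w * Real.sqrt (Real.log (1 / η) / 2) / Real.sqrt n with hτ
  set D : (ℝ → ℝ) → (Fin n → X) → ℝ := fun φ z => ⨆ g : G, (1 * ∫ x, φ ((g : X → ℝ) x) ∂q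
    + ∑ k, (-(1 / (n : ℝ))) * φ ((g : X → ℝ) (z k))) with hD
  have hDm : ∀ φ, Continuous φ → Measurable (D φ) := fun φ hφ =>
    hM.2 φ hφ n 1 fun _ => -(1 / (n : ℝ))
  have hle : ∀ φ : ℝ → ℝ, (∃ B, ∀ t, |t| ≤ Cg → |φ t| ≤ B) → ∀ z, ∀ g ∈ G,
      ∫ x, φ (g x) ∂q - (1 / (n : ℝ)) * ∑ k, φ (g (z k)) ≤ D φ z := by
    rintro φ ⟨B, hB⟩ z g hg
    have hDb : ∀ g : G, |1 * ∫ x, φ ((g : X → ℝ) x) ∂q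
        + ∑ k, (-(1 / (n : ℝ))) * φ ((g : X → ℝ) (z k))|
          ≤ B + (∑ _k : Fin n, |-(1 / (n : ℝ))|) * B := fun g => by
      rw [one_mul]
      exact (abs_add_le _ _).trans (add_le_add
        (abs_integral_le_of_abs_le fun x => hB _ (hG g g.2 x))
        (abs_sum_mul_le _ fun k => hB _ (hG g g.2 _)))
    refine le_trans (le_of_eq ?_) (le_ciSup (bddAbove_range_of_abs_le hDb) ⟨g, hg⟩)
    rw [← Finset.mul_sum]; ring
  have hbd : ∀ t, |t| ≤ Cg → |φ t| ≤ |m| + w := fun t ht => by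
    obtain ⟨h1, h2⟩ := hmwφ t ht
    rw [abs_le]
    constructor <;> linarith [neg_abs_le m, le_abs_self m]
  have hA := measureReal_lt_ciSup_sub_le hne hG hM hφ hw hmwφ hn hη0 hη1
  have hA' := measureReal_lt_ciSup_sub_le hne hG hM hφ.neg (m := -(m + w)) hw
    (fun t ht => by
      have := hmwφ t ht
      constructor <;> simp only [Pi.neg_apply] <;> linarith [this.1, this.2]) hn hη0 hη1
  have hmeas : ∀ φ, Continuous φ → MeasurableSet {z | τ < D φ z} := fun φ hφ =>
    measurableSet_lt measurable_const (hDm φ hφ)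
  refine ⟨({z | τ < D φ z} ∪ {z | τ < D (-φ) z})ᶜ,
    ((hmeas φ hφ.continuous).union (hmeas _ hφ.neg.continuous)).compl, ?_, fun z hz g hg => ?_⟩
  · rw [probReal_compl_eq_one_sub ((hmeas φ hφ.continuous).union (hmeas _ hφ.neg.continuous))]
    have := measureReal_union_le (μ := iidSample q n) {z | τ < D φ z} {z | τ < D (-φ) z}
    change (iidSample q n).real {z | τ < D φ z} ≤ η at hA
    change (iidSample q n).real {z | τ < D (-φ) z} ≤ η at hA'
    linarith
  · simp only [Set.mem_compl_iff, Set.mem_union, Set.mem_ofPred_eq, not_or, not_lt] at hz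
    have h1 := (hle φ ⟨_, hbd⟩ z g hg).trans hz.1
    have h2 := (hle (-φ) ⟨_, fun t ht => (abs_neg (φ t)).trans_le (hbd t ht)⟩ z g hg).trans hz.2
    simp only [Pi.neg_apply, integral_neg, Finset.sum_neg_distrib] at h2
    have e : ∀ x, φ (g x) = ψ (g x) := fun x => hφψ _ (hG g hg x)
    simp only [e] at h1 h2
    rw [abs_le]
    constructor <;> linarith

/-! ### Decomposition of a joint distribution by class -/

instance : MeasurableSingletonClass Label :=
  ⟨fun c => ⟨{(c : ℤ)}, measurableSet_singleton _, by ext d; simp [Units.ext_iff]⟩⟩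

lemma measurableSet_snd_eq {X : Type*} [MeasurableSpace X] (c : Label) :
    MeasurableSet ((Prod.snd : X × Label → Label) ⁻¹' {c}) :=
  measurable_snd (measurableSet_singleton c)

lemma isProbabilityMeasure_classCond {X : Type*} [MeasurableSpace X]
    (P : Measure (X × Label)) [IsProbabilityMeasure P] {c : Label} (hc : 0 < classPrior P c) :
    IsProbabilityMeasure (classCond P c) := by
  have h0 : P (Prod.snd ⁻¹' {c}) ≠ 0 := fun h => by
    simp [classPrior, Measure.real, h] at hc
  have := cond_isProbabilityMeasure h0
  exact Measure.isProbabilityMeasure_map measurable_fst.aemeasurable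

instance {X : Type*} [MeasurableSpace X] (P : Measure (X × Label)) [IsProbabilityMeasure P] :
    IsProbabilityMeasure (marginal P) :=
  Measure.isProbabilityMeasure_map measurable_fst.aemeasurable

lemma setIntegral_label_eq {X : Type*} [MeasurableSpace X] (P : Measure (X × Label))
    [IsProbabilityMeasure P] {c : Label} (hc : 0 < classPrior P c) {f : X → ℝ}
    (hf : Measurable f) :
    ∫ z in Prod.snd ⁻¹' {c}, f z.1 ∂P = classPrior P c * ∫ x, f x ∂(classCond P c) := by
  unfold classCond
  rw [integral_map measurable_fst.aemeasurable hf.aestronglyMeasurable, ProbabilityTheory.cond,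
    integral_smul_measure, ENNReal.toReal_inv, smul_eq_mul]
  exact (mul_inv_cancel_left₀ hc.ne' _).symm

/-- The law of total expectation over the two classes. -/
lemma integral_eq_classPrior_add {X : Type*} [MeasurableSpace X] (P : Measure (X × Label))
    [IsProbabilityMeasure P] (hpos : 0 < classPrior P 1) (hneg : 0 < classPrior P (-1))
    {h : X → Label → ℝ} {B : ℝ} (hm : ∀ c, Measurable fun x => h x c) (hB : ∀ x c, |h x c| ≤ B) :
    ∫ z, h z.1 z.2 ∂P = classPrior P 1 * ∫ x, h x 1 ∂(classCond P 1)
      + classPrior P (-1) * ∫ x, h x (-1) ∂(classCond P (-1)) := by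
  have hh : Measurable fun z : X × Label => h z.1 z.2 :=
    measurable_from_prod_countable_left hm
  have hcompl : ((Prod.snd : X × Label → Label) ⁻¹' {1})ᶜ = Prod.snd ⁻¹' {-1} := by
    ext z
    rcases Int.units_eq_one_or z.2 with hz | hz <;> simp [hz]
  have hset : ∀ c : Label, ∫ z in Prod.snd ⁻¹' {c}, h z.1 z.2 ∂P
      = ∫ z in Prod.snd ⁻¹' {c}, h z.1 c ∂P := fun c =>
    setIntegral_congr_fun (measurableSet_snd_eq c) fun z hz => by
      rw [show z.2 = c from hz]
  rw [← integral_add_compl (measurableSet_snd_eq 1) (integrable_of_abs_le hh fun z => hB _ _),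
    hcompl, hset, hset, setIntegral_label_eq P hpos (hm 1), setIntegral_label_eq P hneg (hm (-1))]

lemma integral_marginal_eq {X : Type*} [MeasurableSpace X] (P : Measure (X × Label))
    [IsProbabilityMeasure P] (hpos : 0 < classPrior P 1) (hneg : 0 < classPrior P (-1))
    {f : X → ℝ} {B : ℝ} (hf : Measurable f) (hB : ∀ x, |f x| ≤ B) :
    ∫ x, f x ∂(marginal P) = classPrior P 1 * ∫ x, f x ∂(classCond P 1)
      + classPrior P (-1) * ∫ x, f x ∂(classCond P (-1)) := by
  rw [marginal, integral_map measurable_fst.aemeasurable hf.aestronglyMeasurable]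
  exact integral_eq_classPrior_add P hpos hneg (h := fun x _ => f x) (fun _ => hf) fun x _ => hB x

/-- The expectation of the semi-supervised risk estimator is the risk. The two losses on negative
data are kept under one integral: their combination has Lipschitz constant and range `1 + a` times
those of the loss. -/
lemma risk_eq_semisupervised {X : Type*} [MeasurableSpace X]
    (P : Measure (X × Label)) [IsProbabilityMeasure P]
    (hpos : 0 < classPrior P 1) (hneg : 0 < classPrior P (-1))
    (loss : ℝ → Label → ℝ) (a : ℝ) {g : X → ℝ} {B : ℝ}
    (hm : ∀ c, Measurable fun x => loss (g x) c) (hB : ∀ x c, |loss (g x) c| ≤ B) :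
    risk P loss g = a * ∫ x, loss (g x) 1 ∂(marginal P)
      + (1 - a) * classPrior P 1 * ∫ x, loss (g x) 1 ∂(classCond P 1)
      + classPrior P (-1) * ∫ x, (loss (g x) (-1) - a * loss (g x) 1) ∂(classCond P (-1)) := by
  have := isProbabilityMeasure_classCond P hneg
  rw [integral_sub (integrable_of_abs_le (hm _) fun x => hB x _)
    ((integrable_of_abs_le (hm _) fun x => hB x _).const_mul a), integral_const_mul,
    integral_marginal_eq P hpos hneg (hm 1) fun x => hB x 1, risk,
    integral_eq_classPrior_add P hpos hneg (h := fun x c => loss (g x) c) hm hB]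
  ring

/-! ### The excess risk bound -/

/-- Deviation bounds for `g` on the three samples combine, with the weights of the estimator, into a
bound for the deviation of the semi-supervised estimator from the risk. -/
lemma abs_risk_sub_semiRisk_le {X : Type*} [MeasurableSpace X]
    (P : Measure (X × Label)) [IsProbabilityMeasure P]
    (hpos : 0 < classPrior P 1) (hneg : 0 < classPrior P (-1))
    (loss : ℝ → Label → ℝ) {a : ℝ} (ha0 : 0 < a) (ha1 : a < 1) {g : X → ℝ} {B : ℝ}
    (hm : ∀ c, Measurable fun x => loss (g x) c) (hB : ∀ x c, |loss (g x) c| ≤ B)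
    {np nn nu : ℕ} {xp : Fin np → X} {xn : Fin nn → X} {xu : Fin nu → X} {τp τn τu : ℝ}
    (hp : |∫ x, loss (g x) 1 ∂(classCond P 1)
      - (1 / (np : ℝ)) * ∑ k, loss (g (xp k)) 1| ≤ τp)
    (hn : |∫ x, (loss (g x) (-1) - a * loss (g x) 1) ∂(classCond P (-1))
      - (1 / (nn : ℝ)) * ∑ k, (loss (g (xn k)) (-1) - a * loss (g (xn k)) 1)| ≤ τn)
    (hu : |∫ x, loss (g x) 1 ∂(marginal P)
      - (1 / (nu : ℝ)) * ∑ k, loss (g (xu k)) 1| ≤ τu) :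
    |risk P loss g - semiRisk P loss a xp xn xu g|
      ≤ (1 - a) * classPrior P 1 * τp + classPrior P (-1) * τn + a * τu := by
  rw [risk_eq_semisupervised P hpos hneg loss a hm hB]
  unfold semiRisk empRisk
  rw [Finset.sum_sub_distrib, ← Finset.mul_sum] at hn
  rw [abs_le] at hp hn hu ⊢
  have hc : 0 ≤ (1 - a) * classPrior P 1 := mul_nonneg (by linarith) hpos.le
  have p1 := mul_le_mul_of_nonneg_left hp.1 hc
  have p2 := mul_le_mul_of_nonneg_left hp.2 hc
  have n1 := mul_le_mul_of_nonneg_left hn.1 hneg.le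
  have n2 := mul_le_mul_of_nonneg_left hn.2 hneg.le
  have u1 := mul_le_mul_of_nonneg_left hu.1 ha0.le
  have u2 := mul_le_mul_of_nonneg_left hu.2 ha0.le
  constructor <;> linarith

/-- The estimated risk at a minimizer `ghat` is at most that at `gstar`, so the excess risk of `ghat`
is at most twice the uniform deviation between risk and estimated risk. -/
theorem theorem3 {X : Type*} [MeasurableSpace X]
    (P : Measure (X × Label)) [IsProbabilityMeasure P]
    (hpos : 0 < classPrior P 1) (hneg : 0 < classPrior P (-1))
    (loss : ℝ → Label → ℝ) (a : ℝ) (ha0 : 0 < a) (ha1 : a < 1)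
    (G : Set (X → ℝ)) (Cg : ℝ) (hG : ∀ g ∈ G, ∀ x, |g x| ≤ Cg)
    (hGp : MeasurableClass G (classCond P 1))
    (hGn : MeasurableClass G (classCond P (-1)))
    (hGu : MeasurableClass G (marginal P))
    (Cl : ℝ) (hCl : 0 < Cl) (hloss : ∀ t, |t| ≤ Cg → ∀ y, 0 ≤ loss t y ∧ loss t y ≤ Cl)
    (L : NNReal) (hL : ∀ y, LipschitzOnWith L (fun t => loss t y) {t | |t| ≤ Cg})
    (np nn nu : ℕ) (hnp : 0 < np) (hnn : 0 < nn) (hnu : 0 < nu)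
    (gstar : X → ℝ) (hgstar : gstar ∈ G) (hmin : IsMinOn (risk P loss) G gstar)
    (δ : ℝ) (hδ0 : 0 < δ) (hδ1 : δ < 1) :
    ∃ E : Set ((Fin np → X) × (Fin nn → X) × (Fin nu → X)), MeasurableSet E ∧
      1 - δ ≤ (sampleLaw P np nn nu).real E ∧
      ∀ xp xn xu, (xp, xn, xu) ∈ E →
        ∀ ghat ∈ G, IsMinOn (semiRisk P loss a xp xn xu) G ghat →
          risk P loss ghat - risk P loss gstar ≤
            4 * (1 - a) * classPrior P 1 * L * rademacher G (classCond P 1) np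
            + 4 * (a + 1) * classPrior P (-1) * L * rademacher G (classCond P (-1)) nn
            + 4 * a * L * rademacher G (marginal P) nu
            + 2 * Cl * Real.sqrt (Real.log (6 / δ) / 2)
              * ((1 - a) * classPrior P 1 / Real.sqrt np
                + (1 + a) * classPrior P (-1) / Real.sqrt nn
                + a / Real.sqrt nu) := by
  have := isProbabilityMeasure_classCond P hpos
  have := isProbabilityMeasure_classCond P hneg
  have hne : G.Nonempty := ⟨gstar, hgstar⟩
  -- one sixth of the failure probability for each side of each sample
  have hη0 : 0 < δ / 6 := by linarith
  have hη1 : δ / 6 ≤ 1 := by linarith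
  have hL1 : LipschitzOnWith ((1 + a).toNNReal * L) (fun t => loss t (-1) - a * loss t 1)
      {t | |t| ≤ Cg} := by
    refine LipschitzOnWith.of_dist_le_mul fun s hs t ht => ?_
    have h1 := (hL 1).dist_le_mul s hs t ht
    have h2 := (hL (-1)).dist_le_mul s hs t ht
    rw [NNReal.coe_mul, Real.coe_toNNReal _ (by linarith)]
    rw [Real.dist_eq] at h1 h2 ⊢
    have h3 := mul_le_mul_of_nonneg_left h1 ha0.le
    rw [← abs_of_pos ha0, ← abs_mul, abs_of_pos ha0] at h3
    calc _ = |(loss s (-1) - loss t (-1)) - a * (loss s 1 - loss t 1)| := by congr 1; ring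
      _ ≤ _ := abs_sub _ _
      _ ≤ _ := by linarith
  obtain ⟨Ep, hEp, hPp, hdp⟩ := exists_measurableSet_uniform_deviation hne hG hGp (hL 1) (m := 0)
    hCl (fun t ht => by simpa using hloss t ht 1) hnp hη0 hη1
  obtain ⟨Eu, hEu, hPu, hdu⟩ := exists_measurableSet_uniform_deviation hne hG hGu (hL 1) (m := 0)
    hCl (fun t ht => by simpa using hloss t ht 1) hnu hη0 hη1
  obtain ⟨En, hEn, hPn, hdn⟩ := exists_measurableSet_uniform_deviation hne hG hGn hL1
    (m := -(a * Cl)) (w := (1 + a) * Cl) (by positivity) (fun t ht => by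
      have h1 := hloss t ht 1
      have h2 := hloss t ht (-1)
      have h3 := mul_le_mul_of_nonneg_left h1.2 ha0.le
      have h4 := mul_nonneg ha0.le h1.1
      constructor <;> linarith) hnn hη0 hη1
  refine ⟨Ep ×ˢ En ×ˢ Eu, hEp.prod (hEn.prod hEu), ?_, fun xp xn xu hx ghat hghat hhat => ?_⟩
  · rw [sampleLaw, measureReal_prod_prod, measureReal_prod_prod]
    have h0 : 0 ≤ 1 - 2 * (δ / 6) := by linarith
    have h1 := mul_le_mul hPp (mul_le_mul hPn hPu h0 measureReal_nonneg) (mul_nonneg h0 h0)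
      measureReal_nonneg
    refine le_trans ?_ h1
    nlinarith [mul_pos hδ0 hδ0]
  · obtain ⟨hxp, hxn, hxu⟩ := hx
    have key : ∀ g ∈ G, |risk P loss g - semiRisk P loss a xp xn xu g| ≤ _ := fun g hg =>
      abs_risk_sub_semiRisk_le P hpos hneg loss ha0 ha1 (B := Cl)
        (fun c => by
          obtain ⟨φ, hφ, heq⟩ := (hL c).extend_real
          rw [show (fun x => loss (g x) c) = fun x => φ (g x) from
            funext fun x => heq (hG g hg x)]
          exact hφ.continuous.measurable.comp (hGp.1 g hg))
        (fun x c => by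
          have := hloss _ (hG g hg x) c
          rw [abs_of_nonneg this.1]; exact this.2)
        (hdp xp hxp g hg) (hdn xn hxn g hg) (hdu xu hxu g hg)
    have h1 := (abs_le.1 (key ghat hghat)).2
    have h2 := (abs_le.1 (key gstar hgstar)).1
    have h3 : semiRisk P loss a xp xn xu ghat ≤ semiRisk P loss a xp xn xu gstar := hhat hgstar
    have hδ : 1 / (δ / 6) = 6 / δ := by rw [one_div_div]
    rw [NNReal.coe_mul, Real.coe_toNNReal _ (by linarith : (0 : ℝ) ≤ 1 + a), hδ] at h1 h2
    calc risk P loss ghat - risk P loss gstar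
        ≤ 2 * ((1 - a) * classPrior P 1 * (2 * L * rademacher G (classCond P 1) np
            + Cl * Real.sqrt (Real.log (6 / δ) / 2) / Real.sqrt np)
          + classPrior P (-1) * (2 * ((1 + a) * L) * rademacher G (classCond P (-1)) nn
            + (1 + a) * Cl * Real.sqrt (Real.log (6 / δ) / 2) / Real.sqrt nn)
          + a * (2 * L * rademacher G (marginal P) nu
            + Cl * Real.sqrt (Real.log (6 / δ) / 2) / Real.sqrt nu)) := by linarith
      _ = _ := by ring
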